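/- Conventions: simplicial complexes are abstract simplicial complexes, $H_k$ is simplicial $k$-homology with coefficients in an abelian group, and the vertices of a complex are its $0$-dimensional faces. A complex is pure $d$-dimensional if every face is contained in a $d$-dimensional face. A pure $n$-dimensional complex is strongly connected if any two of its $n$-dimensional faces are equivalent under the transitive closure of the relation of sharing an $(n-1)$-dimensional face. A complex is strongly connected with respect to dimension $m$ if all its maximal faces have dimension at least $m$ and its $m$-skeleton is strongly connected. Theorem. Let $1\le k\le d$ and $m$ be integers with $m>d+1-\left\lceil\frac{d+1}{k+1}\right\rceil$. (1) Let $X$ be a pure $d$-dimensional simplicial complex that is strongly connected with respect to dimension $m$, and suppose that $H_k(X;A)\neq 0$ for some abelian group $A$. Then $X$ has at least $d+1+\left\lceil\frac{m}{k}\right\rceil$ vertices. (2) The bound is tight: if moreover $m\le d$ (as is automatic when a complex as in (1) exists), there is a pure $d$-dimensional simplicial complex $X$ that is strongly connected with respect to dimension $m$, has exactly $d+1+\left\lceil\frac{m}{k}\right\rceil$ vertices, and satisfies $H_k(X;A)\neq 0$ for every nonzero abelian group $A$. -/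

import Mathlib

universe u v

namespace PreAbstractSimplicialComplex

variable {V : Type v}

/-- The vertices of a simplicial complex: the points `v` such that `{v}` is a face. -/
def vertexSet (X : PreAbstractSimplicialComplex V) : Set V :=
  {v | {v} ∈ X.faces}

/-- `σ` is an `n`-dimensional face of `X`, that is, a face with `n + 1` vertices. -/
def IsFaceOfDim (X : PreAbstractSimplicialComplex V) (n : ℕ) (σ : Finset V) : Prop :=
  σ ∈ X.faces ∧ σ.card = n + 1

/-- `X` is pure `d`-dimensional: every face is contained in a `d`-dimensional face. -/
def IsPure (X : PreAbstractSimplicialComplex V) (d : ℕ) : Prop :=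
  ∀ σ ∈ X.faces, ∃ τ, X.IsFaceOfDim d τ ∧ σ ⊆ τ

/-- The `n`-skeleton of `X`: all faces of dimension at most `n`. -/
def skeleton (X : PreAbstractSimplicialComplex V) (n : ℕ) : PreAbstractSimplicialComplex V where
  faces := {σ | σ ∈ X.faces ∧ σ.card ≤ n + 1}
  isRelLowerSet_faces := fun _ h =>
    ⟨(X.isRelLowerSet_faces h.1).1, fun _ hle hne =>
      ⟨(X.isRelLowerSet_faces h.1).2 hle hne, (Finset.card_le_card hle).trans h.2⟩⟩

/-- `σ` and `τ` are `d`-dimensional faces of `X` which share a `(d - 1)`-dimensional face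
(a common subset with `d` elements). -/
def SharesFace (X : PreAbstractSimplicialComplex V) (d : ℕ) (σ τ : Finset V) : Prop :=
  X.IsFaceOfDim d σ ∧ X.IsFaceOfDim d τ ∧ ∃ ρ : Finset V, ρ ⊆ σ ∧ ρ ⊆ τ ∧ ρ.card = d

/-- The pure `d`-dimensional complex `X` is strongly connected: any two of its `d`-dimensional
faces are equivalent under the transitive closure of `SharesFace`. -/
def StronglyConnected (X : PreAbstractSimplicialComplex V) (d : ℕ) : Prop :=
  X.IsPure d ∧
    ∀ σ τ, X.IsFaceOfDim d σ → X.IsFaceOfDim d τ → Relation.TransGen (X.SharesFace d) σ τ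

/-- `X` is strongly connected with respect to dimension `m`: all maximal faces of `X` have
dimension at least `m`, and the `m`-skeleton of `X` is strongly connected. -/
def StronglyConnectedWrt (X : PreAbstractSimplicialComplex V) (m : ℕ) : Prop :=
  (∀ σ, Maximal (· ∈ X.faces) σ → m + 1 ≤ σ.card) ∧ (X.skeleton m).StronglyConnected m

/-- The group of simplicial `n`-chains of `X` with coefficients in `A`: the finitely supported
`A`-valued functions on the `n`-dimensional faces of `X` (extended by zero to all finite sets). -/
def chains (X : PreAbstractSimplicialComplex V) (A : Type u) [AddCommGroup A] (n : ℕ) :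
    AddSubgroup (Finset V →₀ A) where
  carrier := {c | ∀ σ ∈ c.support, X.IsFaceOfDim n σ}
  zero_mem' := by simp
  add_mem' := by
    classical
    intro a b ha hb σ hσ
    rcases Finset.mem_union.1 (Finsupp.support_add hσ) with h | h
    · exact ha σ h
    · exact hb σ h
  neg_mem' := by
    intro a ha σ hσ
    exact ha σ (by simpa using hσ)

variable [LinearOrder V]

/-- The simplicial boundary operator for the orientations given by a linear order of the vertices:
`∂ (a · [v₀ < ⋯ < vₙ]) = ∑ i, (-1) ^ i a · [v₀ < ⋯ < vᵢ₋₁ < vᵢ₊₁ < ⋯ < vₙ]` for `n ≥ 1`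
(the index of a vertex of `σ` is the number of smaller vertices of `σ`), and the boundary of a
vertex is `0`. -/
noncomputable def boundary (V : Type v) [LinearOrder V] (A : Type u) [AddCommGroup A] :
    (Finset V →₀ A) →+ (Finset V →₀ A) :=
  Finsupp.liftAddHom fun σ =>
    if σ.card ≤ 1 then 0
    else ∑ v ∈ σ, (-1 : ℤ) ^ (σ.filter (· < v)).card • Finsupp.singleAddHom (σ.erase v)

/-- The simplicial `n`-cycles of `X`. -/
noncomputable def cycles (X : PreAbstractSimplicialComplex V) (A : Type u) [AddCommGroup A]
    (n : ℕ) : AddSubgroup (Finset V →₀ A) :=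
  X.chains A n ⊓ (boundary V A).ker

/-- The simplicial `n`-boundaries of `X`: the boundaries of the `(n + 1)`-chains of `X`. -/
noncomputable def boundaries (X : PreAbstractSimplicialComplex V) (A : Type u) [AddCommGroup A]
    (n : ℕ) : AddSubgroup (Finset V →₀ A) :=
  (X.chains A (n + 1)).map (boundary V A)

theorem boundary_single (A : Type u) [AddCommGroup A] (σ : Finset V) (a : A) :
    boundary V A (Finsupp.single σ a) = if σ.card ≤ 1 then 0
      else ∑ v ∈ σ, (-1 : ℤ) ^ (σ.filter (· < v)).card • Finsupp.single (σ.erase v) a := by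
  rw [boundary, Finsupp.liftAddHom_apply_single]
  split_ifs
  · rfl
  · simp

/-- The boundary operator squares to zero. -/
theorem boundary_boundary (A : Type u) [AddCommGroup A] (c : Finset V →₀ A) :
    boundary V A (boundary V A c) = 0 := by
  suffices h : (boundary V A).comp (boundary V A) = 0 from DFunLike.congr_fun h c
  refine Finsupp.addHom_ext fun σ a => ?_
  rw [AddMonoidHom.comp_apply, boundary_single, AddMonoidHom.zero_apply]
  split_ifs with h1
  · simp
  rw [map_sum]
  by_cases h2 : σ.card ≤ 2
  · refine Finset.sum_eq_zero fun v hv => ?_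
    rw [map_zsmul, boundary_single, if_pos (by rw [Finset.card_erase_of_mem hv]; omega), smul_zero]
  have h3 : ∀ v ∈ σ, ¬ (σ.erase v).card ≤ 1 := fun v hv => by
    rw [Finset.card_erase_of_mem hv]; omega
  rw [Finset.sum_congr rfl fun v hv => by
    rw [map_zsmul, boundary_single, if_neg (h3 v hv), Finset.smul_sum]]
  rw [Finset.sum_sigma']
  have key : ∀ v ∈ σ, ∀ w ∈ σ, v < w →
      ((-1 : ℤ) ^ (σ.filter (· < v)).card * (-1) ^ ((σ.erase v).filter (· < w)).card) +
      ((-1 : ℤ) ^ (σ.filter (· < w)).card * (-1) ^ ((σ.erase w).filter (· < v)).card) = 0 := by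
    intro v hv w hw hvw
    have e1 : ((σ.erase w).filter (· < v)) = σ.filter (· < v) := by
      ext x; simp only [Finset.mem_filter, Finset.mem_erase]
      constructor
      · tauto
      · rintro ⟨hx, hxv⟩; exact ⟨⟨(hxv.trans hvw).ne, hx⟩, hxv⟩
    have e2 : ((σ.erase v).filter (· < w)).card + 1 = (σ.filter (· < w)).card := by
      rw [Finset.filter_erase, Finset.card_erase_add_one]
      simp [hv, hvw]
    rw [e1, ← e2, pow_succ]; ring
  refine Finset.sum_involution (fun p _ => ⟨p.2, p.1⟩) ?_ ?_ ?_ ?_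
  · rintro ⟨v, w⟩ hp
    simp only [Finset.mem_sigma, Finset.mem_erase] at hp
    obtain ⟨hv, hne, hw⟩ := hp
    simp only [Finset.erase_right_comm (a := w) (b := v), smul_smul, ← add_smul]
    rcases lt_or_gt_of_ne hne with h | h
    · rw [add_comm, key w hw v hv h, zero_smul]
    · rw [key v hv w hw h, zero_smul]
  · rintro ⟨v, w⟩ hp _ h
    simp only [Finset.mem_sigma, Finset.mem_erase] at hp
    simp only [Sigma.mk.injEq] at h
    exact hp.2.1 h.1
  · rintro ⟨v, w⟩ hp
    simp only [Finset.mem_sigma, Finset.mem_erase] at hp ⊢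
    exact ⟨hp.2.2, hp.2.1.symm, hp.1⟩
  · rintro ⟨v, w⟩ hp; rfl

/-- Every boundary is a cycle. -/
theorem boundaries_le_cycles (X : PreAbstractSimplicialComplex V) (A : Type u) [AddCommGroup A]
    (n : ℕ) : X.boundaries A n ≤ X.cycles A n := by
  classical
  rintro _ ⟨c, hc, rfl⟩
  refine ⟨?_, boundary_boundary A c⟩
  rw [← Finsupp.sum_single c, Finsupp.sum, map_sum]
  refine AddSubgroup.sum_mem _ fun σ hσ => ?_
  have hf := hc σ hσ
  rw [boundary_single, if_neg (by have := hf.2; omega)]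
  refine AddSubgroup.sum_mem _ fun v hv => AddSubgroup.zsmul_mem _ ?_ _
  intro τ hτ
  obtain rfl : τ = σ.erase v := by simpa using Finsupp.support_single_subset hτ
  have hcard : (σ.erase v).card = n + 1 := by rw [Finset.card_erase_of_mem hv, hf.2]; rfl
  exact ⟨(X.isRelLowerSet_faces hf.1).2 (Finset.erase_subset _ _)
    (Finset.card_pos.1 (by omega)), hcard⟩

/-- The simplicial homology group `H_n(X; A)`: cycles modulo boundaries. -/
abbrev Homology (X : PreAbstractSimplicialComplex V) (A : Type u) [AddCommGroup A] (n : ℕ) :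
    Type (max u v) :=
  X.cycles A n ⧸ (X.boundaries A n).addSubgroupOf (X.cycles A n)

end PreAbstractSimplicialComplex

-- Lower bound. Suppose that `X` has `d + 1 + c` vertices with `c < ⌈m / k⌉`, that is, `c * k < m`.
-- Cover `X` by its `d`-faces. Each of them misses only `c` vertices, so any `k` of them together
-- with two more that share at least `m` vertices have a common vertex, because `m - k * c > 0`.
-- Strong connectivity in dimension `m` links any two `d`-faces through `d`-faces that pairwise
-- share `m` vertices. Sliding a cone apex along such links shows that every ordered `k`-cycle on
-- the set of `d`-faces bounds in the nerve of the cover (`exists_listBoundary_eq_of_moves`).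
--
-- This vanishing is carried back to `X` by half of a nerve lemma (`cycles_le_boundaries_of_nerve`).
-- Subdivide a cycle and replace each simplex by a chosen `d`-face containing it; fill the result in
-- the nerve; return to `X` by iterated cones over common vertices. The round trip is homotopic to
-- the identity inside `X`, by an acyclic carrier argument: a union of simplices with a common
-- vertex is a cone.
--
-- Tightness. Distribute `d + 1 + ⌈m / k⌉` vertices over `k + 2` nonempty blocks and take the
-- `d`-skeleton of the complex of sets missing some block. Collapsing the blocks maps it to the
-- boundary of a `(k + 1)`-simplex, and a transversal of the blocks gives a `k`-cycle that maps to
-- the generator there. Block sizes at most `⌈m / k⌉`, with one distinguished block of size at most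
-- `d + 1 - m`, give purity and strong connectivity; `ceil_bounds` shows that such sizes exist.

universe w

namespace PreAbstractSimplicialComplex

/-! ### Chains supported on a set of generators -/

section Supported

variable {ι κ : Type*} {A : Type u} [AddCommGroup A] {M : Type*} [AddCommGroup M]

/-- The finitely supported functions whose support is contained in `s`. -/
def supportedOn (A : Type u) [AddCommGroup A] (s : Set ι) : AddSubgroup (ι →₀ A) where
  carrier := {c | ∀ i ∈ c.support, i ∈ s}
  zero_mem' := by simp
  add_mem' := by
    classical
    intro a b ha hb i hi
    rcases Finset.mem_union.1 (Finsupp.support_add hi) with h | h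
    · exact ha i h
    · exact hb i h
  neg_mem' := by
    intro a ha i hi
    exact ha i (by simpa using hi)

theorem single_mem_supportedOn {s : Set ι} {i : ι} (hi : i ∈ s) (a : A) :
    Finsupp.single i a ∈ supportedOn A s := by
  intro j hj
  obtain rfl : j = i := by simpa using Finsupp.support_single_subset hj
  exact hi

theorem supportedOn_mono {s t : Set ι} (h : s ⊆ t) : supportedOn A s ≤ supportedOn A t :=
  fun _ hc i hi => h (hc i hi)

theorem map_mem_of_supportedOn {s : Set ι} (f : (ι →₀ A) →+ M) (B : AddSubgroup M)
    (h : ∀ i ∈ s, ∀ a, f (Finsupp.single i a) ∈ B) {c : ι →₀ A} (hc : c ∈ supportedOn A s) :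
    f c ∈ B := by
  rw [← Finsupp.sum_single c, Finsupp.sum, map_sum]
  exact AddSubgroup.sum_mem _ fun i hi => h i (hc i hi) _

theorem map_eq_of_supportedOn {s : Set ι} (f g : (ι →₀ A) →+ M)
    (h : ∀ i ∈ s, ∀ a, f (Finsupp.single i a) = g (Finsupp.single i a)) {c : ι →₀ A}
    (hc : c ∈ supportedOn A s) : f c = g c := by
  rw [← Finsupp.sum_single c, Finsupp.sum, map_sum, map_sum]
  exact Finset.sum_congr rfl fun i hi => h i (hc i hi) _

end Supported

/-! ### The augmented complex and its cones -/

section Cone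

variable {V : Type v} [LinearOrder V] {A : Type u} [AddCommGroup A]

/-- The augmented simplicial boundary: vertices are sent to multiples of the empty simplex. -/
noncomputable def augBoundary (V : Type v) [LinearOrder V] (A : Type u) [AddCommGroup A] :
    (Finset V →₀ A) →+ (Finset V →₀ A) :=
  Finsupp.liftAddHom fun σ =>
    ∑ v ∈ σ, (-1 : ℤ) ^ (σ.filter (· < v)).card • Finsupp.singleAddHom (σ.erase v)

theorem augBoundary_single (σ : Finset V) (a : A) :
    augBoundary V A (Finsupp.single σ a) =
      ∑ v ∈ σ, (-1 : ℤ) ^ (σ.filter (· < v)).card • Finsupp.single (σ.erase v) a := by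
  rw [augBoundary, Finsupp.liftAddHom_apply_single]
  simp

theorem boundary_eq_augBoundary {n : ℕ} {c : Finset V →₀ A}
    (hc : c ∈ supportedOn A {σ | σ.card = n + 2}) : boundary V A c = augBoundary V A c := by
  refine map_eq_of_supportedOn _ _ (fun σ hσ a => ?_) hc
  have h : σ.card = n + 2 := hσ
  rw [boundary_single, if_neg (by omega), augBoundary_single]

/-- The oriented cone from the vertex `v`. -/
noncomputable def cone (A : Type u) [AddCommGroup A] (v : V) :
    (Finset V →₀ A) →+ (Finset V →₀ A) :=
  Finsupp.liftAddHom fun σ =>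
    if v ∈ σ then 0
    else (-1 : ℤ) ^ (σ.filter (· < v)).card • Finsupp.singleAddHom (insert v σ)

theorem cone_single (v : V) (σ : Finset V) (a : A) :
    cone A v (Finsupp.single σ a) = if v ∈ σ then 0
      else (-1 : ℤ) ^ (σ.filter (· < v)).card • Finsupp.single (insert v σ) a := by
  rw [cone, Finsupp.liftAddHom_apply_single]
  split_ifs
  · rfl
  · simp

theorem cone_single_of_mem {v : V} {σ : Finset V} (hv : v ∈ σ) (a : A) :
    cone A v (Finsupp.single σ a) = 0 := by
  rw [cone_single, if_pos hv]

theorem cone_single_of_lt {v : V} {σ : Finset V} (hv : ∀ x ∈ σ, v < x) (a : A) :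
    cone A v (Finsupp.single σ a) = Finsupp.single (insert v σ) a := by
  have h : σ.filter (· < v) = ∅ := Finset.filter_eq_empty_iff.2 fun x hx => (hv x hx).not_gt
  rw [cone_single, if_neg fun h => (hv v h).false, h]
  simp

/-- Coning contracts the augmented complex, with no exception in low degrees. If `v ∈ σ`, the cone
of `σ` is zero and only the face `σ.erase v` contributes to the cone of the boundary. -/
theorem augBoundary_cone (v : V) (c : Finset V →₀ A) :
    augBoundary V A (cone A v c) = c - cone A v (augBoundary V A c) := by
  suffices h : (augBoundary V A).comp (cone A v) =
      AddMonoidHom.id _ - (cone A v).comp (augBoundary V A) from DFunLike.congr_fun h c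
  refine Finsupp.addHom_ext fun σ a => ?_
  simp only [AddMonoidHom.comp_apply, AddMonoidHom.sub_apply, AddMonoidHom.id_apply]
  rw [augBoundary_single, map_sum]
  by_cases hv : v ∈ σ
  · rw [cone_single_of_mem hv, map_zero, Finset.sum_eq_single_of_mem v hv]
    · have e : (σ.erase v).filter (· < v) = σ.filter (· < v) := by
        rw [Finset.filter_erase, Finset.erase_eq_of_notMem (by simp)]
      rw [map_zsmul, cone_single, if_neg (Finset.notMem_erase v σ), Finset.insert_erase hv, e,
        smul_smul, ← mul_pow]
      simp
    · intro w hw hne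
      rw [map_zsmul, cone_single_of_mem (Finset.mem_erase.2 ⟨hne.symm, hv⟩), smul_zero]
  · rw [cone_single, if_neg hv, map_zsmul, augBoundary_single, Finset.sum_insert hv,
      Finset.erase_insert hv, smul_add]
    have e : (insert v σ).filter (· < v) = σ.filter (· < v) := by
      rw [Finset.filter_insert, if_neg (lt_irrefl v)]
    rw [e, smul_smul, ← mul_pow, sub_eq_add_neg, Finset.smul_sum, ← Finset.sum_neg_distrib]
    congr 1
    · simp
    refine Finset.sum_congr rfl fun w hw => ?_
    have hne : w ≠ v := fun h => hv (h ▸ hw)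
    rw [map_zsmul, cone_single, if_neg fun h => hv (Finset.mem_of_mem_erase h), smul_smul,
      smul_smul, ← neg_smul, Finset.erase_insert_of_ne hne.symm]
    congr 1
    rcases lt_or_gt_of_ne hne with h | h
    · have e1 : (insert v σ).filter (· < w) = σ.filter (· < w) := by
        rw [Finset.filter_insert, if_neg h.not_gt]
      have e2 : ((σ.erase w).filter (· < v)).card + 1 = (σ.filter (· < v)).card := by
        rw [Finset.filter_erase, Finset.card_erase_add_one]
        simp [hw, h]
      rw [e1, ← e2, pow_succ]; ring
    · have e1 : ((insert v σ).filter (· < w)).card = (σ.filter (· < w)).card + 1 := by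
        rw [Finset.filter_insert, if_pos h, Finset.card_insert_of_notMem]
        simp [hv]
      have e2 : (σ.erase w).filter (· < v) = σ.filter (· < v) := by
        rw [Finset.filter_erase, Finset.erase_eq_of_notMem]
        simp [h.le]
      rw [e1, e2, pow_succ]; ring

theorem augBoundary_augBoundary (c : Finset V →₀ A) :
    augBoundary V A (augBoundary V A c) = 0 := by
  suffices h : (augBoundary V A).comp (augBoundary V A) = 0 from DFunLike.congr_fun h c
  refine Finsupp.addHom_ext fun σ a => ?_
  rw [AddMonoidHom.comp_apply, AddMonoidHom.zero_apply]
  induction σ using Finset.induction_on_min with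
  | empty => simp [augBoundary_single]
  | insert v σ hv ih =>
    rw [← cone_single_of_lt hv, augBoundary_cone, map_sub, augBoundary_cone, ih, map_zero]
    abel

theorem augBoundary_single_mem (σ : Finset V) (a : A) :
    augBoundary V A (Finsupp.single σ a) ∈ supportedOn A {τ | ∃ v ∈ σ, τ = σ.erase v} := by
  rw [augBoundary_single]
  refine AddSubgroup.sum_mem _ fun v hv => AddSubgroup.zsmul_mem _ ?_ _
  exact single_mem_supportedOn (Set.mem_ofPred.2 ⟨v, hv, rfl⟩) _

theorem cone_mem {v : V} {s t : Set (Finset V)} (h : ∀ σ ∈ s, v ∉ σ → insert v σ ∈ t)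
    {c : Finset V →₀ A} (hc : c ∈ supportedOn A s) : cone A v c ∈ supportedOn A t := by
  refine map_mem_of_supportedOn _ _ (fun σ hσ a => ?_) hc
  rw [cone_single]
  split_ifs with hv
  · exact zero_mem _
  · exact AddSubgroup.zsmul_mem _ (single_mem_supportedOn (h σ hσ hv) _) _

end Cone

/-! ### Ordered chains -/

section Lists

variable {α β : Type*} {A : Type u} [AddCommGroup A]

/-- Prepending `a` to every list of a chain. -/
noncomputable def consHom (A : Type u) [AddCommGroup A] (a : α) :
    (List α →₀ A) →+ (List α →₀ A) :=
  Finsupp.mapDomain.addMonoidHom (List.cons a)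

@[simp]
theorem consHom_single (a : α) (l : List α) (x : A) :
    consHom A a (Finsupp.single l x) = Finsupp.single (a :: l) x :=
  Finsupp.mapDomain_single

/-- The augmented boundary of an ordered simplex. -/
noncomputable def listBoundaryAux (A : Type u) [AddCommGroup A] :
    List α → (A →+ (List α →₀ A))
  | [] => 0
  | a :: l => Finsupp.singleAddHom l - (consHom A a).comp (listBoundaryAux A l)

/-- The augmented boundary of ordered chains, with `∂ (a :: l) = l - a :: ∂ l`. -/
noncomputable def listBoundary (α : Type*) (A : Type u) [AddCommGroup A] :
    (List α →₀ A) →+ (List α →₀ A) :=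
  Finsupp.liftAddHom (listBoundaryAux A)

@[simp]
theorem listBoundary_nil (x : A) : listBoundary α A (Finsupp.single [] x) = 0 := by
  rw [listBoundary, Finsupp.liftAddHom_apply_single]
  rfl

theorem listBoundary_cons_single (a : α) (l : List α) (x : A) :
    listBoundary α A (Finsupp.single (a :: l) x) =
      Finsupp.single l x - consHom A a (listBoundary α A (Finsupp.single l x)) := by
  simp [listBoundary, listBoundaryAux]

theorem listBoundary_cons (a : α) (c : List α →₀ A) :
    listBoundary α A (consHom A a c) = c - consHom A a (listBoundary α A c) := by
  suffices h : (listBoundary α A).comp (consHom A a) =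
      AddMonoidHom.id _ - (consHom A a).comp (listBoundary α A) from DFunLike.congr_fun h c
  refine Finsupp.addHom_ext fun l x => ?_
  simp [listBoundary_cons_single]

theorem listBoundary_listBoundary (c : List α →₀ A) :
    listBoundary α A (listBoundary α A c) = 0 := by
  suffices h : (listBoundary α A).comp (listBoundary α A) = 0 from DFunLike.congr_fun h c
  refine Finsupp.addHom_ext fun l x => ?_
  rw [AddMonoidHom.comp_apply, AddMonoidHom.zero_apply]
  induction l with
  | nil => simp
  | cons a l ih =>
    rw [listBoundary_cons_single, map_sub, listBoundary_cons, ih, map_zero]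
    abel

theorem listBoundary_single_mem (l : List α) (x : A) :
    listBoundary α A (Finsupp.single l x) ∈
      supportedOn A {l' | l'.Sublist l ∧ l'.length + 1 = l.length} := by
  induction l with
  | nil => simp
  | cons a l ih =>
    rw [listBoundary_cons_single]
    refine sub_mem
      (single_mem_supportedOn (Set.mem_ofPred.2 ⟨List.sublist_cons_self a l, rfl⟩) _) ?_
    refine map_mem_of_supportedOn _ _ (fun l' hl' y => ?_) ih
    rw [consHom_single]
    exact single_mem_supportedOn
      (Set.mem_ofPred.2 ⟨hl'.1.cons_cons a, congrArg (· + 1) hl'.2⟩) _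

/-- The map of ordered chains induced by a map of vertices. -/
noncomputable def listMap (A : Type u) [AddCommGroup A] (f : α → β) :
    (List α →₀ A) →+ (List β →₀ A) :=
  Finsupp.mapDomain.addMonoidHom (List.map f)

@[simp]
theorem listMap_single (f : α → β) (l : List α) (x : A) :
    listMap A f (Finsupp.single l x) = Finsupp.single (l.map f) x :=
  Finsupp.mapDomain_single

theorem listMap_cons (f : α → β) (a : α) (c : List α →₀ A) :
    listMap A f (consHom A a c) = consHom A (f a) (listMap A f c) := by
  suffices h : (listMap A f).comp (consHom A a) = (consHom A (f a)).comp (listMap A f) from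
    DFunLike.congr_fun h c
  exact Finsupp.addHom_ext fun l x => by simp

theorem listBoundary_listMap (f : α → β) (c : List α →₀ A) :
    listBoundary β A (listMap A f c) = listMap A f (listBoundary α A c) := by
  suffices h : (listBoundary β A).comp (listMap A f) = (listMap A f).comp (listBoundary α A) from
    DFunLike.congr_fun h c
  refine Finsupp.addHom_ext fun l x => ?_
  rw [AddMonoidHom.comp_apply, AddMonoidHom.comp_apply]
  induction l with
  | nil => simp
  | cons a l ih =>
    rw [listMap_single] at ih ⊢
    rw [List.map_cons, listBoundary_cons_single, ih, listBoundary_cons_single, map_sub,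
      listMap_cons, listMap_single]

end Lists

/-! ### Chain maps and homotopies built by coning -/

section Lift

variable {ι : Type*} {A : Type u} [AddCommGroup A] {M : Type*} [AddCommGroup M]

/-- The map defined degree by degree by coning off the image of the boundary of each generator,
starting from `e` in the lowest degree. -/
noncomputable def coneLift (d : (ι →₀ A) →+ (ι →₀ A)) (K : ι → (M →+ M)) (e : (ι →₀ A) →+ M) :
    ℕ → ((ι →₀ A) →+ M)
  | 0 => e
  | n + 1 => Finsupp.liftAddHom fun i =>
      (K i).comp ((coneLift d K e n).comp (d.comp (Finsupp.singleAddHom i)))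

theorem coneLift_succ_single (d : (ι →₀ A) →+ (ι →₀ A)) (K : ι → (M →+ M)) (e : (ι →₀ A) →+ M)
    (n : ℕ) (i : ι) (a : A) :
    coneLift d K e (n + 1) (Finsupp.single i a) =
      K i (coneLift d K e n (d (Finsupp.single i a))) := by
  simp [coneLift]

/-- By induction the image of a boundary is a cycle, and the contraction `K i` turns a cycle into a
chain that it bounds. The degree counts vertices, so degree `0` is the augmentation. -/
theorem boundary_coneLift {d : (ι →₀ A) →+ (ι →₀ A)} {K : ι → (M →+ M)} {e : (ι →₀ A) →+ M}
    {δ : M →+ M} (hd : ∀ c, d (d c) = 0) (hK : ∀ i c, δ (K i c) = c - K i (δ c))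
    (he : ∀ c, δ (e c) = 0) (n : ℕ) (c : ι →₀ A) :
    δ (coneLift d K e (n + 1) c) = coneLift d K e n (d c) := by
  suffices h : δ.comp (coneLift d K e (n + 1)) = (coneLift d K e n).comp d from
    DFunLike.congr_fun h c
  refine Finsupp.addHom_ext fun i a => ?_
  rw [AddMonoidHom.comp_apply, AddMonoidHom.comp_apply, coneLift_succ_single, hK]
  cases n with
  | zero => simp [coneLift, he]
  | succ n => rw [boundary_coneLift hd hK he n, hd, map_zero, map_zero, sub_zero]

/-- The homotopy between two families of chain maps defined degree by degree by coning. -/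
noncomputable def coneHomotopy (d : (ι →₀ A) →+ (ι →₀ A)) (K : ι → (M →+ M))
    (f g : ℕ → ((ι →₀ A) →+ M)) : ℕ → ((ι →₀ A) →+ M)
  | 0 => 0
  | n + 1 => Finsupp.liftAddHom fun i => (K i).comp
      ((f (n + 1) - g (n + 1) - (coneHomotopy d K f g n).comp d).comp (Finsupp.singleAddHom i))

theorem coneHomotopy_succ_single (d : (ι →₀ A) →+ (ι →₀ A)) (K : ι → (M →+ M))
    (f g : ℕ → ((ι →₀ A) →+ M)) (n : ℕ) (i : ι) (a : A) :
    coneHomotopy d K f g (n + 1) (Finsupp.single i a) =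
      K i (f (n + 1) (Finsupp.single i a) - g (n + 1) (Finsupp.single i a) -
        coneHomotopy d K f g n (d (Finsupp.single i a))) := by
  simp [coneHomotopy]

theorem boundary_coneHomotopy {d : (ι →₀ A) →+ (ι →₀ A)} {K : ι → (M →+ M)}
    {f g : ℕ → ((ι →₀ A) →+ M)}
    {δ : M →+ M} (hd : ∀ c, d (d c) = 0) (hK : ∀ i c, δ (K i c) = c - K i (δ c))
    (hf : ∀ n c, δ (f (n + 1) c) = f n (d c)) (hg : ∀ n c, δ (g (n + 1) c) = g n (d c))
    (h0 : f 0 = g 0) (n : ℕ) (c : ι →₀ A) :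
    δ (coneHomotopy d K f g (n + 1) c) =
      f (n + 1) c - g (n + 1) c - coneHomotopy d K f g n (d c) := by
  suffices h : δ.comp (coneHomotopy d K f g (n + 1)) =
      f (n + 1) - g (n + 1) - (coneHomotopy d K f g n).comp d from DFunLike.congr_fun h c
  refine Finsupp.addHom_ext fun i a => ?_
  simp only [AddMonoidHom.comp_apply, AddMonoidHom.sub_apply]
  rw [coneHomotopy_succ_single, hK, map_sub δ, map_sub δ, hf, hg]
  cases n with
  | zero => simp [coneHomotopy, h0]
  | succ n => rw [boundary_coneHomotopy hd hK hf hg h0 n, hd]; simp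

end Lift

/-! ### Subdivision, vertex maps, cone maps and their carriers -/

section NerveMaps

variable {α : Type w} {V : Type v} [LinearOrder V] {A : Type u} [AddCommGroup A]

/-- The chain map from ordered chains which sends a list to an iterated cone with apexes `u`. -/
noncomputable def apexMap (A : Type u) [AddCommGroup A] (u : List α → V) :
    ℕ → ((List α →₀ A) →+ (Finset V →₀ A)) :=
  coneLift (listBoundary α A) (fun S => cone A (u S))
    ((Finsupp.singleAddHom ∅).comp (Finsupp.applyAddHom []))

/-- The barycentric subdivision, as a chain map to ordered chains of simplices. -/
noncomputable def subdivision (V : Type v) [LinearOrder V] (A : Type u) [AddCommGroup A] :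
    ℕ → ((Finset V →₀ A) →+ (List (Finset V) →₀ A)) :=
  coneLift (augBoundary V A) (consHom A) ((Finsupp.singleAddHom []).comp (Finsupp.applyAddHom ∅))

/-- The simplicial chain map induced by the map `v` of vertices. -/
noncomputable def vertexMap (A : Type u) [AddCommGroup A] (v : α → V) :
    ℕ → ((List α →₀ A) →+ (Finset V →₀ A))
  | 0 => (Finsupp.singleAddHom ∅).comp (Finsupp.applyAddHom [])
  | n + 1 => Finsupp.liftAddHom fun l => match l with
    | [] => 0
    | a :: l => (cone A (v a)).comp ((vertexMap A v n).comp (Finsupp.singleAddHom l))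

theorem augBoundary_single_empty (a : A) : augBoundary V A (Finsupp.single ∅ a) = 0 := by
  simp [augBoundary_single]

theorem augBoundary_apexMap (u : List α → V) (n : ℕ) (c : List α →₀ A) :
    augBoundary V A (apexMap A u (n + 1) c) = apexMap A u n (listBoundary α A c) :=
  boundary_coneLift listBoundary_listBoundary (fun _ _ => augBoundary_cone _ _)
    (fun _ => augBoundary_single_empty _) n c

theorem listBoundary_subdivision (n : ℕ) (c : Finset V →₀ A) :
    listBoundary _ A (subdivision V A (n + 1) c) = subdivision V A n (augBoundary V A c) :=
  boundary_coneLift augBoundary_augBoundary (fun _ _ => listBoundary_cons _ _)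
    (fun _ => listBoundary_nil _) n c

theorem vertexMap_succ_nil (v : α → V) (n : ℕ) (a : A) :
    vertexMap A v (n + 1) (Finsupp.single [] a) = 0 := by
  rw [vertexMap, Finsupp.liftAddHom_apply_single]; rfl

theorem vertexMap_succ_cons_single (v : α → V) (n : ℕ) (x : α) (l : List α) (a : A) :
    vertexMap A v (n + 1) (Finsupp.single (x :: l) a) =
      cone A (v x) (vertexMap A v n (Finsupp.single l a)) := by
  rw [vertexMap, Finsupp.liftAddHom_apply_single]; rfl

theorem vertexMap_succ_cons (v : α → V) (n : ℕ) (x : α) (c : List α →₀ A) :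
    vertexMap A v (n + 1) (consHom A x c) = cone A (v x) (vertexMap A v n c) := by
  suffices h : (vertexMap A v (n + 1)).comp (consHom A x) = (cone A (v x)).comp (vertexMap A v n)
    from DFunLike.congr_fun h c
  exact Finsupp.addHom_ext fun l a => by simp [vertexMap_succ_cons_single]

theorem augBoundary_vertexMap (v : α → V) (n : ℕ) (c : List α →₀ A) :
    augBoundary V A (vertexMap A v (n + 1) c) = vertexMap A v n (listBoundary α A c) := by
  suffices h : (augBoundary V A).comp (vertexMap A v (n + 1)) =
      (vertexMap A v n).comp (listBoundary α A) from DFunLike.congr_fun h c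
  refine Finsupp.addHom_ext fun l a => ?_
  rw [AddMonoidHom.comp_apply, AddMonoidHom.comp_apply]
  cases l with
  | nil => rw [vertexMap_succ_nil, listBoundary_nil, map_zero, map_zero]
  | cons x l =>
    rw [vertexMap_succ_cons_single, augBoundary_cone, listBoundary_cons_single, map_sub]
    congr 1
    cases n with
    | zero =>
      have h1 : ∀ c, augBoundary V A (vertexMap A v 0 c) = 0 := fun c =>
        augBoundary_single_empty _
      have h2 : ∀ c, vertexMap A v 0 (consHom A x c) = 0 := fun c => by
        suffices h : (vertexMap A v 0).comp (consHom A x) = 0 from DFunLike.congr_fun h c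
        refine Finsupp.addHom_ext fun l a => ?_
        simp [vertexMap]
      rw [h1, h2, map_zero]
    | succ n => rw [augBoundary_vertexMap v n, vertexMap_succ_cons]

theorem apexMap_card (u : List α → V) (n : ℕ) (c : List α →₀ A) :
    apexMap A u n c ∈ supportedOn A {τ | τ.card = n} := by
  have hc : c ∈ supportedOn A Set.univ := fun _ _ => Set.mem_univ _
  refine map_mem_of_supportedOn _ _ (fun S _ a => ?_) hc
  cases n with
  | zero => exact single_mem_supportedOn (by simp) _
  | succ n =>
    rw [apexMap, coneLift_succ_single]
    refine cone_mem (fun σ hσ hu => ?_) (apexMap_card u n _)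
    exact Set.mem_ofPred.2 ((Finset.card_insert_of_notMem hu).trans (congrArg (· + 1) hσ))

theorem vertexMap_card (v : α → V) (n : ℕ) (c : List α →₀ A) :
    vertexMap A v n c ∈ supportedOn A {τ | τ.card = n} := by
  have hc : c ∈ supportedOn A Set.univ := fun _ _ => Set.mem_univ _
  refine map_mem_of_supportedOn _ _ (fun S _ a => ?_) hc
  cases n with
  | zero => exact single_mem_supportedOn (by simp) _
  | succ n =>
    cases S with
    | nil => rw [vertexMap_succ_nil]; exact zero_mem _
    | cons x l =>
      rw [vertexMap_succ_cons_single]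
      refine cone_mem (fun σ hσ hu => ?_) (vertexMap_card v n _)
      exact Set.mem_ofPred.2 ((Finset.card_insert_of_notMem hu).trans (congrArg (· + 1) hσ))

theorem coneHomotopy_card (u : List α → V) (f g : ℕ → ((List α →₀ A) →+ (Finset V →₀ A)))
    (hf : ∀ n c, f n c ∈ supportedOn A {τ | τ.card = n})
    (hg : ∀ n c, g n c ∈ supportedOn A {τ | τ.card = n}) (n : ℕ) (c : List α →₀ A) :
    coneHomotopy (listBoundary α A) (fun S => cone A (u S)) f g n c ∈
      supportedOn A {τ | τ.card = n + 1} := by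
  have hc : c ∈ supportedOn A Set.univ := fun _ _ => Set.mem_univ _
  refine map_mem_of_supportedOn _ _ (fun S _ a => ?_) hc
  cases n with
  | zero => exact zero_mem _
  | succ n =>
    rw [coneHomotopy_succ_single]
    refine cone_mem (fun σ hσ hu => ?_)
      (sub_mem (sub_mem (hf _ _) (hg _ _)) (coneHomotopy_card u f g hf hg n _))
    exact Set.mem_ofPred.2 ((Finset.card_insert_of_notMem hu).trans (congrArg (· + 1) hσ))

/-- The apex `u S` lies in every `F x`, so coning from it preserves the union of the simplices `F
x`, while passing to a sublist only shrinks this union. -/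
theorem apexMap_carrier {F : α → Finset V} {u : List α → V}
    (hu : ∀ S, (∃ v, ∀ x ∈ S, v ∈ F x) → ∀ x ∈ S, u S ∈ F x) (n : ℕ) (S : List α)
    (hS : ∃ v, ∀ x ∈ S, v ∈ F x) (a : A) :
    apexMap A u n (Finsupp.single S a) ∈ supportedOn A {τ | τ = ∅ ∨ ∃ x ∈ S, τ ⊆ F x} := by
  cases n with
  | zero => exact single_mem_supportedOn (by simp) _
  | succ n =>
    rw [apexMap, coneLift_succ_single]
    rcases S.eq_nil_or_concat with rfl | ⟨S', x, hx⟩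
    · rw [listBoundary_nil, map_zero, map_zero]
      exact zero_mem _
    have hxS : x ∈ S := by simp [hx]
    refine cone_mem (s := {τ | τ = ∅ ∨ ∃ x ∈ S, τ ⊆ F x}) (fun σ hσ _ => Or.inr ?_) ?_
    · rcases hσ with rfl | ⟨y, hy, hσ⟩
      · exact ⟨x, hxS, by simpa using hu S hS x hxS⟩
      · exact ⟨y, hy, Finset.insert_subset (hu S hS y hy) hσ⟩
    · refine map_mem_of_supportedOn _ _ (fun T hT b => ?_) (listBoundary_single_mem S a)
      obtain ⟨v, hv⟩ := hS
      refine supportedOn_mono ?_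
        (apexMap_carrier hu n T ⟨v, fun x hx => hv x (hT.1.subset hx)⟩ b)
      rintro τ (h | ⟨y, hy, h⟩)
      · exact Or.inl h
      · exact Or.inr ⟨y, hT.1.subset hy, h⟩

theorem vertexMap_carrier {v : α → V} (n : ℕ) (ρ : Finset V) (S : List α)
    (hS : ∀ x ∈ S, v x ∈ ρ) (a : A) :
    vertexMap A v n (Finsupp.single S a) ∈ supportedOn A {τ | τ ⊆ ρ} := by
  cases n with
  | zero => exact single_mem_supportedOn (by simp) _
  | succ n =>
    cases S with
    | nil => rw [vertexMap_succ_nil]; exact zero_mem _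
    | cons x S =>
      rw [vertexMap_succ_cons_single]
      exact cone_mem (fun τ hτ _ => Finset.insert_subset (hS x (by simp)) hτ)
        (vertexMap_carrier n ρ S (fun y h => hS y (by simp [h])) a)

theorem subdivision_carrier (n : ℕ) (σ : Finset V) (hσ : σ.card = n) (a : A) :
    subdivision V A n (Finsupp.single σ a) ∈ supportedOn A
      {S | S.length = n ∧ S.Pairwise (fun σ τ => τ ⊆ σ) ∧ ∀ τ ∈ S, τ.Nonempty ∧ τ ⊆ σ} := by
  cases n with
  | zero => exact single_mem_supportedOn (by simp) _
  | succ n =>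
    rw [subdivision, coneLift_succ_single]
    refine map_mem_of_supportedOn ((consHom A σ).comp (subdivision V A n)) _ (fun τ hτ b => ?_)
      (augBoundary_single_mem σ a)
    obtain ⟨v, hv, rfl⟩ := hτ
    rw [AddMonoidHom.comp_apply]
    refine map_mem_of_supportedOn _ _ (fun S hS y => ?_)
      (subdivision_carrier n (σ.erase v) (by rw [Finset.card_erase_of_mem hv, hσ]; rfl) b)
    obtain ⟨h1, h2, h3⟩ := hS
    have h4 : ∀ τ ∈ S, τ ⊆ σ := fun τ hτ => (h3 τ hτ).2.trans (Finset.erase_subset _ _)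
    rw [consHom_single]
    refine single_mem_supportedOn (Set.mem_ofPred.2 ⟨by simp [h1], ?_, ?_⟩) _
    · exact List.pairwise_cons.2 ⟨h4, h2⟩
    · intro τ hτ
      rcases List.mem_cons.1 hτ with rfl | hτ
      · exact ⟨⟨v, hv⟩, subset_rfl⟩
      · exact ⟨(h3 τ hτ).1, h4 τ hτ⟩

/-- By induction the composite sends `σ` to the cone of its boundary from `v σ`. As `v σ ∈ σ`, the
cone of `σ` itself vanishes, so `augBoundary_cone` identifies that chain with `σ`. -/
theorem vertexMap_subdivision {v : Finset V → V} (hv : ∀ σ, σ.Nonempty → v σ ∈ σ) (n : ℕ)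
    {c : Finset V →₀ A} (hc : c ∈ supportedOn A {σ | σ.card = n}) :
    vertexMap A v n (subdivision V A n c) = c := by
  refine map_eq_of_supportedOn ((vertexMap A v n).comp (subdivision V A n)) (AddMonoidHom.id _)
    (fun σ hσ a => ?_) hc
  have hσ : σ.card = n := hσ
  rw [AddMonoidHom.comp_apply, AddMonoidHom.id_apply]
  cases n with
  | zero =>
    obtain rfl := Finset.card_eq_zero.1 hσ
    simp [vertexMap, subdivision, coneLift]
  | succ n =>
    have hne : σ.Nonempty := Finset.card_pos.1 (by omega)
    have hb : augBoundary V A (Finsupp.single σ a) ∈ supportedOn A {σ | σ.card = n} := by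
      refine supportedOn_mono ?_ (augBoundary_single_mem σ a)
      rintro _ ⟨w, hw, rfl⟩
      exact Set.mem_ofPred.2 (by rw [Finset.card_erase_of_mem hw, hσ]; rfl)
    rw [subdivision, coneLift_succ_single, vertexMap_succ_cons]
    rw [show coneLift _ _ _ n = subdivision V A n from rfl, vertexMap_subdivision hv n hb]
    have h := augBoundary_cone (v σ) (Finsupp.single σ a)
    rw [cone_single_of_mem (hv σ hne), map_zero] at h
    exact (sub_eq_zero.1 h.symm).symm

/-- The last set of a descending flag lies in all the others. -/
theorem exists_mem_of_pairwise {V : Type v} [Nonempty V] (S : List (Finset V))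
    (h : S.Pairwise (fun σ τ => τ ⊆ σ)) (hne : ∀ σ ∈ S, σ.Nonempty) : ∃ v, ∀ σ ∈ S, v ∈ σ := by
  induction S with
  | nil => simp
  | cons σ S ih =>
    rw [List.pairwise_cons] at h
    obtain ⟨v, hv⟩ := ih h.2 fun τ hτ => hne τ (by simp [hτ])
    cases S with
    | nil =>
      obtain ⟨w, hw⟩ := hne σ (by simp)
      exact ⟨w, by simpa using hw⟩
    | cons τ S =>
      refine ⟨v, fun ρ hρ => ?_⟩
      rcases List.mem_cons.1 hρ with rfl | hρ
      · exact h.1 τ (by simp) (hv τ (by simp))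
      · exact hv ρ hρ

/-- Both maps stay in the union of the `F σ`: the vertices chosen by `v` lie in the head of the
flag, its largest member `ρ ⊆ F ρ`. This union is a cone with apex `u (S.map F)`, so the homotopy
stays there too. -/
theorem coneHomotopy_carrier {F : Finset V → Finset V} {u : List (Finset V) → V}
    {v : Finset V → V}
    (hv : ∀ σ, σ.Nonempty → v σ ∈ σ) (hu : ∀ S, (∃ v, ∀ F ∈ S, v ∈ F) → ∀ F ∈ S, u S ∈ F)
    (n : ℕ) (S : List (Finset V)) (hS : ∃ v, ∀ σ ∈ S, v ∈ F σ)
    (hp : S.Pairwise (fun σ τ => τ ⊆ σ)) (hne : ∀ σ ∈ S, σ.Nonempty) (hF : ∀ σ ∈ S, σ ⊆ F σ)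
    (a : A) :
    coneHomotopy (listBoundary (Finset V) A) (fun S => cone A (u (S.map F)))
      (fun n => (apexMap A u n).comp (listMap A F)) (vertexMap A v) n (Finsupp.single S a) ∈
      supportedOn A {τ | τ = ∅ ∨ ∃ σ ∈ S, τ ⊆ F σ} := by
  cases n with
  | zero => exact zero_mem _
  | succ n =>
    have hS' : ∃ v, ∀ G ∈ S.map F, v ∈ G := by simpa using hS
    rw [coneHomotopy_succ_single]
    cases S with
    | nil =>
      rw [listBoundary_nil, map_zero, vertexMap_succ_nil, AddMonoidHom.comp_apply, listMap_single]
      rw [apexMap, List.map_nil, coneLift_succ_single, listBoundary_nil]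
      simp
    | cons ρ S =>
      set T := ρ :: S with hT
      have hρ : ρ ∈ T := by simp [hT]
      have hu' : ∀ σ ∈ T, u (T.map F) ∈ F σ := fun σ hσ =>
        hu _ hS' _ (List.mem_map_of_mem hσ)
      refine cone_mem (s := {τ | τ = ∅ ∨ ∃ σ ∈ T, τ ⊆ F σ}) (fun σ hσ _ => Or.inr ?_) ?_
      · rcases hσ with rfl | ⟨y, hy, hσ⟩
        · exact ⟨ρ, hρ, by simpa using hu' ρ hρ⟩
        · exact ⟨y, hy, Finset.insert_subset (hu' y hy) hσ⟩
      refine sub_mem (sub_mem ?_ ?_) ?_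
      · rw [AddMonoidHom.comp_apply, listMap_single]
        refine supportedOn_mono ?_ (apexMap_carrier (F := id) hu (n + 1) (T.map F) hS' a)
        rintro τ (h | ⟨y, hy, h⟩)
        · exact Or.inl h
        · obtain ⟨σ, hσ, rfl⟩ := List.mem_map.1 hy
          exact Or.inr ⟨σ, hσ, h⟩
      · refine supportedOn_mono ?_ (vertexMap_carrier (n + 1) ρ T (fun σ hσ => ?_) a)
        · exact fun τ hτ => Or.inr ⟨ρ, hρ, Finset.Subset.trans hτ (hF ρ hρ)⟩
        · refine (?_ : σ ⊆ ρ) (hv σ (hne σ hσ))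
          rcases List.mem_cons.1 hσ with rfl | hσ
          · exact subset_rfl
          · exact (List.pairwise_cons.1 hp).1 σ hσ
      · refine map_mem_of_supportedOn _ _ (fun R hR b => ?_) (listBoundary_single_mem T a)
        have hs := hR.1.subset
        obtain ⟨x, hx⟩ := hS
        refine supportedOn_mono ?_ (coneHomotopy_carrier hv hu n R ⟨x, fun σ h => hx σ (hs h)⟩
          (hp.sublist hR.1) (fun σ h => hne σ (hs h)) (fun σ h => hF σ (hs h)) b)
        rintro τ (h | ⟨y, hy, h⟩)
        · exact Or.inl h
        · exact Or.inr ⟨y, hs hy, h⟩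

end NerveMaps

/-! ### From filling in the nerve to filling in the complex -/

section Nerve

variable {V : Type v} [LinearOrder V] {A : Type u} [AddCommGroup A]

/-- If every `k`-cycle of the full complex of ordered chains on a set `𝓕` of faces that covers `X`
bounds in the nerve of `𝓕`, then every `k`-cycle of `X` is a boundary. -/
theorem cycles_le_boundaries_of_nerve (X : PreAbstractSimplicialComplex V)
    {𝓕 : Set (Finset V)} (hsub : 𝓕 ⊆ X.faces) (hcover : ∀ σ ∈ X.faces, ∃ F ∈ 𝓕, σ ⊆ F)
    {k : ℕ} (hk : 1 ≤ k)
    (hN : ∀ y ∈ supportedOn A {S : List (Finset V) | S.length = k + 1 ∧ ∀ F ∈ S, F ∈ 𝓕},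
      listBoundary _ A y = 0 →
      ∃ e ∈ supportedOn A {S : List (Finset V) | (∀ F ∈ S, F ∈ 𝓕) ∧ ∃ v, ∀ F ∈ S, v ∈ F},
        listBoundary _ A e = y) :
    X.cycles A k ≤ X.boundaries A k := by
  classical
  rintro z ⟨hz, hz0⟩
  rcases isEmpty_or_nonempty V with hV | hV
  · have : z = 0 := by
      refine Finsupp.ext fun σ => ?_
      by_contra h
      have := (hz σ (by simpa using h)).2
      rw [Finset.eq_empty_of_isEmpty σ] at this
      simp at this
    rw [this]
    exact zero_mem _
  choose! F hF𝓕 hF using hcover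
  -- Both choices are made total by an arbitrary value; only lists with a common vertex and nonempty
  -- sets matter.
  have hu0 : ∀ S : List (Finset V), ∃ w, (∃ v, ∀ F ∈ S, v ∈ F) → ∀ F ∈ S, w ∈ F := fun S => by
    by_cases h : ∃ v, ∀ F ∈ S, v ∈ F
    · exact ⟨h.choose, fun _ => h.choose_spec⟩
    · exact ⟨Classical.arbitrary V, fun h' => absurd h' h⟩
  choose u hu using hu0
  have hv0 : ∀ σ : Finset V, ∃ v, σ.Nonempty → v ∈ σ := fun σ => by
    by_cases h : σ.Nonempty
    · exact ⟨h.choose, fun _ => h.choose_spec⟩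
    · exact ⟨Classical.arbitrary V, fun h' => absurd h' h⟩
  choose v hv using hv0
  have hzc : z ∈ supportedOn A {σ | σ.card = k + 1} := fun σ hσ => (hz σ hσ).2
  obtain ⟨j, rfl⟩ : ∃ j, k = j + 1 := ⟨k - 1, by omega⟩
  have hz0 : augBoundary V A z = 0 := (boundary_eq_augBoundary hzc).symm.trans hz0
  set s := subdivision V A (j + 2) z with hs
  have hs0 : listBoundary _ A s = 0 := by rw [hs, listBoundary_subdivision, hz0, map_zero]
  have hsc : s ∈ supportedOn A {S | S.length = j + 2 ∧ S.Pairwise (fun σ τ => τ ⊆ σ) ∧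
      ∀ τ ∈ S, τ.Nonempty ∧ τ ∈ X.faces} := by
    refine map_mem_of_supportedOn _ _ (fun σ hσ a => ?_) hz
    refine supportedOn_mono ?_ (subdivision_carrier (j + 2) σ hσ.2 a)
    rintro S ⟨h1, h2, h3⟩
    exact ⟨h1, h2, fun τ hτ => ⟨(h3 τ hτ).1,
      (X.isRelLowerSet_faces hσ.1).2 (h3 τ hτ).2 (h3 τ hτ).1⟩⟩
  obtain ⟨e, he, hey⟩ := hN (listMap A F s) (by
    refine map_mem_of_supportedOn _ _ (fun S hS a => ?_) hsc
    rw [listMap_single]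
    refine single_mem_supportedOn (Set.mem_ofPred.2 ⟨by simp [hS.1], ?_⟩) _
    intro G hG
    obtain ⟨σ, hσ, rfl⟩ := List.mem_map.1 hG
    exact hF𝓕 _ (hS.2.2 σ hσ).2) (by rw [listBoundary_listMap, hs0, map_zero])
  let H := coneHomotopy (listBoundary (Finset V) A) (fun S => cone A (u (S.map F)))
      (fun n => (apexMap A u n).comp (listMap A F)) (vertexMap A v)
  have hHcard : ∀ n c, H n c ∈ supportedOn A {τ | τ.card = n + 1} := fun n c =>
    coneHomotopy_card (fun S => u (S.map F)) (fun n => (apexMap A u n).comp (listMap A F))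
      (vertexMap A v) (fun n c => apexMap_card u n (listMap A F c)) (vertexMap_card v) n c
  have hH : augBoundary V A (H (j + 2) s) =
      apexMap A u (j + 2) (listMap A F s) - vertexMap A v (j + 2) s -
        H (j + 1) (listBoundary _ A s) := by
    refine boundary_coneHomotopy listBoundary_listBoundary (fun _ _ => augBoundary_cone _ _)
      (fun n c => ?_) (augBoundary_vertexMap v) ?_ (j + 1) s
    · rw [AddMonoidHom.comp_apply, augBoundary_apexMap, listBoundary_listMap]
      rfl
    · refine Finsupp.addHom_ext fun S a => ?_
      rw [AddMonoidHom.comp_apply, listMap_single]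
      cases S <;> simp [apexMap, coneLift, vertexMap]
  -- The homotopy formula becomes `∂ (H s) = ∂ (apexMap e) - z`, which dictates the filling of `z`
  -- below.
  rw [hs0, map_zero, sub_zero, hs, vertexMap_subdivision hv _ hzc, ← hs, ← hey,
    ← augBoundary_apexMap] at hH
  have hmem : ∀ c : Finset V →₀ A, c ∈ supportedOn A {τ | τ.card = j + 3} →
      c ∈ supportedOn A {τ | τ = ∅ ∨ τ ∈ X.faces} → c ∈ X.chains A (j + 2) := by
    intro c h1 h2 τ hτ
    have h3 : τ.card = j + 3 := h1 τ hτ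
    rcases h2 τ hτ with rfl | h
    · simp at h3
    · exact ⟨h, h3⟩
  have hface : ∀ G ∈ X.faces, ∀ τ ⊆ G, τ = ∅ ∨ τ ∈ X.faces := fun G hG τ hτ =>
    τ.eq_empty_or_nonempty.imp_right fun h => (X.isRelLowerSet_faces hG).2 hτ h
  refine ⟨apexMap A u (j + 3) e - H (j + 2) s, sub_mem (hmem _ ?_ ?_) (hmem _ ?_ ?_), ?_⟩
  · exact apexMap_card _ _ _
  · refine map_mem_of_supportedOn _ _ (fun S hS a => ?_) he
    refine supportedOn_mono ?_ (apexMap_carrier (F := id) hu (j + 3) S hS.2 a)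
    rintro τ (h | ⟨G, hG, h⟩)
    · exact Or.inl h
    · exact hface G (hsub (hS.1 G hG)) τ h
  · exact hHcard (j + 2) s
  · refine map_mem_of_supportedOn _ _ (fun S hS a => ?_) hsc
    obtain ⟨x, hx⟩ := exists_mem_of_pairwise S hS.2.1 fun σ hσ => (hS.2.2 σ hσ).1
    have hSF : ∀ σ ∈ S, σ ⊆ F σ := fun σ hσ => hF _ (hS.2.2 σ hσ).2
    refine supportedOn_mono ?_ (coneHomotopy_carrier hv hu (j + 2) S
      ⟨x, fun σ hσ => hSF σ hσ (hx σ hσ)⟩ hS.2.1 (fun σ hσ => (hS.2.2 σ hσ).1) hSF a)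
    rintro τ (h | ⟨σ, hσ, h⟩)
    · exact Or.inl h
    · exact hface (F σ) (hsub (hF𝓕 _ (hS.2.2 σ hσ).2)) τ h
  · rw [boundary_eq_augBoundary (n := j + 1), map_sub, hH]
    · abel
    · exact sub_mem (apexMap_card u (j + 3) e) (hHcard (j + 2) s)

end Nerve

theorem nontrivial_homology_iff {V : Type v} [LinearOrder V] (X : PreAbstractSimplicialComplex V)
    (A : Type u) [AddCommGroup A] (k : ℕ) :
    Nontrivial (X.Homology A k) ↔ ¬ X.cycles A k ≤ X.boundaries A k := by
  rw [QuotientAddGroup.nontrivial_iff, Ne, AddSubgroup.addSubgroupOf_eq_top]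

/-! ### The lower bound on the number of vertices -/

section LowerBound

/-- Ordered cycles on `𝓕` bound in `N` if any two elements of `𝓕` are linked by moves such that
adding both ends of a move to an ordered simplex with `k` vertices gives an element of `N`. -/
theorem exists_listBoundary_eq_of_moves {α : Type v} {A : Type u} [AddCommGroup A]
    {𝓕 : Set α} {N : Set (List α)} {k : ℕ} {adj : α → α → Prop}
    (hrefl : ∀ x ∈ 𝓕, adj x x)
    (hconn : ∀ x ∈ 𝓕, ∀ y ∈ 𝓕, Relation.ReflTransGen adj x y)
    (hN : ∀ x y T, adj x y → T.length = k → (∀ z ∈ T, z ∈ 𝓕) → x :: y :: T ∈ N)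
    {c : List α →₀ A} (hc : c ∈ supportedOn A {S : List α | S.length = k + 1 ∧ ∀ x ∈ S, x ∈ 𝓕})
    (hc0 : listBoundary α A c = 0) :
    ∃ e ∈ supportedOn A N, listBoundary α A e = c := by
  let B := (supportedOn A N).map (listBoundary α A)
  have move : ∀ x y, adj x y → ∀ T : List α, T.length = k + 1 → (∀ z ∈ T, z ∈ 𝓕) → ∀ a : A,
      listBoundary α A (Finsupp.single (x :: T) a) -
        listBoundary α A (Finsupp.single (y :: T) a) ∈ B := by
    intro x y hxy T hT hT𝓕 a
    -- Modulo sign conventions, `∂ (x :: T) - ∂ (y :: T) = y :: ∂ T - x :: ∂ T = ∂ (x :: y :: ∂ T)`;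
    -- the lists in `∂ T` have the `k` entries that `hN` allows.
    refine ⟨consHom A x (consHom A y (listBoundary α A (Finsupp.single T a))), ?_, ?_⟩
    · refine map_mem_of_supportedOn ((consHom A x).comp (consHom A y)) _ (fun S hS b => ?_)
        (listBoundary_single_mem T a)
      rw [AddMonoidHom.comp_apply, consHom_single, consHom_single]
      have h2 : S.length + 1 = T.length := hS.2
      exact single_mem_supportedOn
        (hN x y S hxy (by omega) fun z hz => hT𝓕 z (hS.1.subset hz)) _
    · rw [listBoundary_cons, listBoundary_cons, listBoundary_listBoundary,
        listBoundary_cons_single, listBoundary_cons_single, map_zero, sub_zero]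
      abel
  have key : ∀ x ∈ 𝓕, ∀ T : List α, T.length = k + 1 → (∀ z ∈ T, z ∈ 𝓕) → ∀ a : A,
      listBoundary α A (Finsupp.single (x :: T) a) ∈ B := by
    intro x hx T hT hT𝓕 a
    match T, hT, hT𝓕 with
    | y :: T', hT, hT𝓕 =>
      have hy : y ∈ 𝓕 := hT𝓕 y (by simp)
      -- The apex slides from `x` to the head `y` of `T`, where `y :: y :: T'` is in `N` because `y`
      -- is linked to itself.
      refine Relation.ReflTransGen.head_induction_on (hconn x hx y hy) ?_ ?_
      · exact ⟨_, single_mem_supportedOn (hN y y T' (hrefl y hy) (by simpa using hT)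
          fun z hz => hT𝓕 z (by simp [hz])) _, rfl⟩
      · intro x z hxz _ ih
        have := add_mem (move x z hxz _ hT hT𝓕 a) ih
        rwa [sub_add_cancel] at this
  rcases 𝓕.eq_empty_or_nonempty with rfl | ⟨x, hx⟩
  · refine ⟨0, zero_mem _, ?_⟩
    rw [map_zero]
    refine Finsupp.ext fun S => ?_
    by_contra h
    obtain ⟨h1, h2⟩ := hc S (by simpa using Ne.symm h)
    match S, h1, h2 with
    | y :: S, _, h2 => exact h2 y (by simp)
  -- A cycle `c` equals `∂ (x :: c)`, so it suffices to treat each `x :: T`.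
  · have h := listBoundary_cons x c
    rw [hc0, map_zero, sub_zero] at h
    have hB : ((listBoundary α A).comp (consHom A x)) c ∈ B := by
      refine map_mem_of_supportedOn _ _ (fun T hT a => ?_) hc
      rw [AddMonoidHom.comp_apply, consHom_single]
      exact key x hx T hT.1 hT.2 a
    rw [AddMonoidHom.comp_apply, h] at hB
    exact hB

/-- Each `F` in `T` misses at most `c` points of `W`, so intersecting with it costs `ρ` at most `c`
points. -/
theorem exists_subset_inter_list {V : Type v} [DecidableEq V] {W : Finset V} {d c : ℕ}
    (hW : W.card ≤ d + 1 + c) (T : List (Finset V)) (hT : ∀ F ∈ T, F ⊆ W ∧ F.card = d + 1)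
    (ρ : Finset V) (hρ : ρ ⊆ W) :
    ∃ ρ' ⊆ ρ, (∀ F ∈ T, ρ' ⊆ F) ∧ ρ.card ≤ ρ'.card + T.length * c := by
  induction T with
  | nil => exact ⟨ρ, subset_rfl, by simp, by simp⟩
  | cons F T ih =>
    obtain ⟨ρ', h1, h2, h3⟩ := ih fun G hG => hT G (by simp [hG])
    obtain ⟨hFW, hF⟩ := hT F (by simp)
    refine ⟨ρ' ∩ F, Finset.inter_subset_left.trans h1, fun G hG => ?_, ?_⟩
    · rcases List.mem_cons.1 hG with rfl | hG
      · exact Finset.inter_subset_right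
      · exact Finset.inter_subset_left.trans (h2 G hG)
    · have h4 := Finset.card_inter_add_card_sdiff ρ' F
      have h5 : (ρ' \ F).card ≤ (W \ F).card :=
        Finset.card_le_card (Finset.sdiff_subset_sdiff (h1.trans hρ) subset_rfl)
      have h6 := Finset.card_sdiff_add_card_eq_card hFW
      rw [List.length_cons, add_mul]
      omega

/-- Extend every `m`-face on the path to a `d`-face by purity; consecutive ones contain the `m`
shared vertices. -/
theorem reflTransGen_facets {V : Type v} [DecidableEq V] {X : PreAbstractSimplicialComplex V}
    {d m : ℕ} (hX : X.IsPure d) {σ τ : Finset V}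
    (h : Relation.TransGen ((X.skeleton m).SharesFace m) σ τ) {F : Finset V}
    (hF : X.IsFaceOfDim d F) (hσ : σ ⊆ F) :
    ∀ {F' : Finset V}, X.IsFaceOfDim d F' → τ ⊆ F' → Relation.ReflTransGen
      (fun F F' => X.IsFaceOfDim d F ∧ X.IsFaceOfDim d F' ∧ m ≤ (F ∩ F').card) F F' := by
  have step : ∀ {σ τ F F' : Finset V}, (X.skeleton m).SharesFace m σ τ → σ ⊆ F → τ ⊆ F' →
      m ≤ (F ∩ F').card := by
    rintro σ τ F F' ⟨-, -, ρ, h1, h2, h3⟩ hσ hτ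
    rw [← h3]
    exact Finset.card_le_card (Finset.subset_inter (h1.trans hσ) (h2.trans hτ))
  induction h with
  | single h => exact fun hF' hτ => .single ⟨hF, hF', step h hσ hτ⟩
  | tail _ h ih =>
    intro F' hF' hτ
    obtain ⟨G, hG, hbG⟩ := hX _ h.1.1.1
    exact (ih hG hbG).tail ⟨hG, hF', step h hbG hτ⟩

theorem le_encard_vertexSet {d k m : ℕ} (hk : 1 ≤ k) {A : Type u} [AddCommGroup A] {V : Type v}
    [LinearOrder V] {X : PreAbstractSimplicialComplex V} (hX : X.IsPure d)
    (hm : X.StronglyConnectedWrt m) (hH : Nontrivial (X.Homology A k)) :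
    ((d + 1 + ⌈(m : ℚ) / (k : ℚ)⌉₊ : ℕ) : ℕ∞) ≤ X.vertexSet.encard := by
  rw [nontrivial_homology_iff] at hH
  by_contra! hlt
  have hfin : X.vertexSet.Finite := Set.finite_of_encard_le_coe hlt.le
  set W := hfin.toFinset with hWdef
  have hWcard : W.card < d + 1 + ⌈(m : ℚ) / (k : ℚ)⌉₊ := by
    rw [hfin.encard_eq_coe_toFinset_card] at hlt
    exact_mod_cast hlt
  have hface : ∀ F ∈ X.faces, F ⊆ W := fun F hF v hv => by
    rw [hWdef, Set.Finite.mem_toFinset]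
    exact (X.isRelLowerSet_faces hF).2 (Finset.singleton_subset_iff.2 hv)
      (Finset.singleton_nonempty v)
  obtain ⟨G, hG⟩ : ∃ G, X.IsFaceOfDim d G := by
    by_contra! h
    refine hH fun z hz => ?_
    have : z = 0 := by
      refine Finsupp.ext fun σ => ?_
      by_contra h0
      obtain ⟨F, hF, -⟩ := hX σ (hz.1 σ (by simpa using h0)).1
      exact h F hF
    rw [this]
    exact zero_mem _
  -- By purity the `d`-face `G` is maximal.
  have hmd : m ≤ d := by
    have := hm.1 G ⟨hG.1, fun τ hτ hle => by
      obtain ⟨F, hF, hτF⟩ := hX τ hτ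
      have : G = F := Finset.eq_of_subset_of_card_le (hle.trans hτF) (hF.2.trans hG.2.symm).le
      exact hτF.trans this.ge⟩
    rw [hG.2] at this
    omega
  obtain ⟨c, hc⟩ : ∃ c, W.card = d + 1 + c :=
    ⟨W.card - (d + 1), by have := Finset.card_le_card (hface G hG.1); rw [hG.2] at this; omega⟩
  have hck : c * k < m := by
    have h1 : c < ⌈(m : ℚ) / (k : ℚ)⌉₊ := by omega
    rw [Nat.lt_ceil, lt_div_iff₀ (by exact_mod_cast hk)] at h1
    exact_mod_cast h1
  refine hH (cycles_le_boundaries_of_nerve X (𝓕 := {F | X.IsFaceOfDim d F}) (fun F hF => hF.1) hX hk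
    fun y hy hy0 => exists_listBoundary_eq_of_moves (k := k)
      (adj := fun F F' => X.IsFaceOfDim d F ∧ X.IsFaceOfDim d F' ∧ m ≤ (F ∩ F').card)
      (fun F hF => ?_) (fun F hF F' hF' => ?_) (fun F F' T hadj hT hT𝓕 => ?_) hy hy0)
  · have hF : X.IsFaceOfDim d F := hF
    exact ⟨hF, hF, by rw [Finset.inter_self, hF.2]; omega⟩
  · have hF : X.IsFaceOfDim d F := hF
    have hF' : X.IsFaceOfDim d F' := hF'
    have sub : ∀ F, X.IsFaceOfDim d F → ∃ σ ⊆ F, (X.skeleton m).IsFaceOfDim m σ := fun F hF => by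
      obtain ⟨σ, h1, h2⟩ := Finset.exists_subset_card_eq (s := F) (n := m + 1)
        (by rw [hF.2]; omega)
      exact ⟨σ, h1, ⟨(X.isRelLowerSet_faces hF.1).2 h1 (Finset.card_pos.1 (by omega)), h2.le⟩, h2⟩
    obtain ⟨σ, hσF, hσ⟩ := sub F hF
    obtain ⟨τ, hτF, hτ⟩ := sub F' hF'
    exact reflTransGen_facets hX (hm.2.2 σ τ hσ hτ) hF hσF hF' hτF
  · obtain ⟨hF, hF', hcard⟩ := hadj
    obtain ⟨ρ, h1, h2, h3⟩ := exists_subset_inter_list hc.le T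
      (fun G hG => ⟨hface G (hT𝓕 G hG).1, (hT𝓕 G hG).2⟩) (F ∩ F')
      (Finset.inter_subset_left.trans (hface F hF.1))
    rw [hT, mul_comm] at h3
    -- At least `m - k * c > 0` vertices are common to `F`, `F'` and the `k` members of `T`.
    obtain ⟨v, hv⟩ : ρ.Nonempty := Finset.card_pos.1 (by omega)
    have hv' := Finset.mem_inter.1 (h1 hv)
    refine ⟨fun G hG => ?_, v, fun G hG => ?_⟩
    · rcases List.mem_cons.1 hG with rfl | hG
      · exact hF
      rcases List.mem_cons.1 hG with rfl | hG
      · exact hF'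
      · exact hT𝓕 G hG
    · rcases List.mem_cons.1 hG with rfl | hG
      · exact hv'.1
      rcases List.mem_cons.1 hG with rfl | hG
      · exact hv'.2
      · exact h2 G hG hv

end LowerBound

/-! ### Simplicial chains as sorted ordered chains -/

section SortedLists

variable {V : Type v} [LinearOrder V] {A : Type u} [AddCommGroup A]

/-- Listing the vertices of every simplex of a chain in increasing order. -/
noncomputable def sortHom (V : Type v) [LinearOrder V] (A : Type u) [AddCommGroup A] :
    (Finset V →₀ A) →+ (List V →₀ A) :=
  Finsupp.mapDomain.addMonoidHom fun σ => σ.sort (· ≤ ·)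

@[simp]
theorem sortHom_single (σ : Finset V) (a : A) :
    sortHom V A (Finsupp.single σ a) = Finsupp.single (σ.sort (· ≤ ·)) a :=
  Finsupp.mapDomain_single

theorem sort_insert_of_lt {v : V} {σ : Finset V} (hv : ∀ x ∈ σ, v < x) :
    (insert v σ).sort (· ≤ ·) = v :: σ.sort (· ≤ ·) :=
  Finset.sort_insert (· ≤ ·) (fun x hx => (hv x hx).le) fun h => (hv v h).false

theorem sortHom_cone {v : V} {c : Finset V →₀ A}
    (hc : c ∈ supportedOn A {σ | ∀ x ∈ σ, v < x}) :
    sortHom V A (cone A v c) = consHom A v (sortHom V A c) := by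
  refine map_eq_of_supportedOn ((sortHom V A).comp (cone A v))
    ((consHom A v).comp (sortHom V A)) (fun σ hσ a => ?_) hc
  rw [AddMonoidHom.comp_apply, AddMonoidHom.comp_apply, cone_single_of_lt hσ, sortHom_single,
    sort_insert_of_lt hσ, sortHom_single, consHom_single]

theorem listBoundary_sortHom (c : Finset V →₀ A) :
    listBoundary V A (sortHom V A c) = sortHom V A (augBoundary V A c) := by
  suffices h : (listBoundary V A).comp (sortHom V A) = (sortHom V A).comp (augBoundary V A) from
    DFunLike.congr_fun h c
  refine Finsupp.addHom_ext fun σ a => ?_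
  rw [AddMonoidHom.comp_apply, AddMonoidHom.comp_apply]
  induction σ using Finset.induction_on_min with
  | empty => simp [augBoundary_single]
  | insert v σ hv ih =>
    have hb : augBoundary V A (Finsupp.single σ a) ∈ supportedOn A {σ | ∀ x ∈ σ, v < x} := by
      refine supportedOn_mono ?_ (augBoundary_single_mem σ a)
      rintro _ ⟨w, -, rfl⟩
      exact fun x hx => hv x (Finset.mem_of_mem_erase hx)
    rw [← cone_single_of_lt hv, augBoundary_cone, map_sub, sortHom_cone hb, ← ih,
      cone_single_of_lt hv, sortHom_single, sort_insert_of_lt hv, listBoundary_cons_single,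
      sortHom_single]

theorem vertexMap_single_of_nodup {α : Type w} (f : α → V) (l : List α) (hl : (l.map f).Nodup)
    (a : A) : ∃ ε : ℤ, ε * ε = 1 ∧ vertexMap A f l.length (Finsupp.single l a) =
      ε • Finsupp.single (l.map f).toFinset a := by
  induction l with
  | nil => exact ⟨1, by simp, by simp [vertexMap]⟩
  | cons x l ih =>
    rw [List.map_cons, List.nodup_cons] at hl
    obtain ⟨ε, h1, h2⟩ := ih hl.2
    rw [List.length_cons, vertexMap_succ_cons_single, h2, map_zsmul, cone_single,
      if_neg (by simpa using hl.1), smul_smul, List.map_cons, List.toFinset_cons]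
    refine ⟨_, ?_, rfl⟩
    rw [mul_mul_mul_comm, h1, ← mul_pow]
    simp

end SortedLists

/-! ### Homology and connectivity of the block complex -/

section Blocks

variable {V : Type v} {k : ℕ}

/-- The `d`-skeleton of the complex of all nonempty sets of vertices that miss some fiber of `β`
(a blow-up of the boundary of a simplex). -/
def blockComplex {ι : Type w} (β : V → ι) (d : ℕ) : PreAbstractSimplicialComplex V where
  faces := {σ | σ.Nonempty ∧ σ.card ≤ d + 1 ∧ ∃ i, ∀ v ∈ σ, β v ≠ i}
  isRelLowerSet_faces := fun _ h => ⟨h.1, fun _ hle hne =>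
    ⟨hne, (Finset.card_le_card hle).trans h.2.1, h.2.2.imp fun _ hi v hv => hi v (hle hv)⟩⟩

/-- The boundary of a transversal simplex `σ` is a cycle, since each facet of `σ` misses a block. A
filling would push forward along `β` to a filling of the boundary of the `(k + 1)`-simplex inside
that boundary. -/
theorem nontrivial_homology_blockComplex [LinearOrder V] {β : V → Fin (k + 2)}
    (hβ : Function.Surjective β) (hk : 1 ≤ k) {d : ℕ} (hkd : k ≤ d) (A : Type u) [AddCommGroup A]
    [Nontrivial A] : Nontrivial ((blockComplex β d).Homology A k) := by
  rw [nontrivial_homology_iff]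
  intro hle
  obtain ⟨a, ha⟩ := exists_ne (0 : A)
  let s := Function.surjInv hβ
  have hs : ∀ i, β (s i) = i := Function.surjInv_eq hβ
  have hsinj : Function.Injective s := Function.injective_surjInv hβ
  let σ : Finset V := Finset.univ.map ⟨s, hsinj⟩
  have hσ : σ.card = k + 2 := by simp [σ]
  have hσβ : ∀ x ∈ σ, s (β x) = x := by
    intro x hx
    obtain ⟨i, -, rfl⟩ := Finset.mem_map.1 hx
    exact congrArg s (hs i)
  have hz : augBoundary V A (Finsupp.single σ a) ∈ (blockComplex β d).chains A k := by
    refine supportedOn_mono ?_ (augBoundary_single_mem σ a)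
    rintro _ ⟨v, hv, rfl⟩
    have hc : (σ.erase v).card = k + 1 := by rw [Finset.card_erase_of_mem hv, hσ]; rfl
    refine ⟨⟨Finset.card_pos.1 (by omega), by omega, β v, fun w hw h => ?_⟩, hc⟩
    rw [Finset.mem_erase] at hw
    exact hw.1 (by rw [← hσβ w hw.2, h, hσβ v hv])
  obtain ⟨j, rfl⟩ : ∃ j, k = j + 1 := ⟨k - 1, by omega⟩
  obtain ⟨w, hw, hwz⟩ := hle ⟨hz, (boundary_eq_augBoundary (n := j) fun τ hτ => (hz τ hτ).2).trans
    (augBoundary_augBoundary _)⟩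
  rw [boundary_eq_augBoundary (n := j + 1) fun τ hτ => (hw τ hτ).2] at hwz
  have hP : ∀ c, augBoundary _ A (vertexMap A β (j + 3) (sortHom V A c)) =
      vertexMap A β (j + 2) (sortHom V A (augBoundary V A c)) := fun c => by
    rw [augBoundary_vertexMap, listBoundary_sortHom]
  -- Every simplex of `w` misses a block `i`, and no set of `k + 2` elements of `Fin (k + 2)` avoids
  -- `i`.
  have hPw : vertexMap A β (j + 3) (sortHom V A w) = 0 := by
    refine map_eq_of_supportedOn ((vertexMap A β (j + 3)).comp (sortHom V A)) 0
      (fun τ hτ b => ?_) hw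
    obtain ⟨⟨-, -, i, hi⟩, -⟩ := hτ
    rw [AddMonoidHom.comp_apply, sortHom_single, AddMonoidHom.zero_apply]
    refine Finsupp.ext fun ρ => ?_
    by_contra h
    have hρ := Finsupp.mem_support_iff.2 h
    have h1 : ρ.card = j + 3 := vertexMap_card _ _ _ ρ hρ
    have h2 : ρ ⊆ Finset.univ.erase i := vertexMap_carrier (j + 3) _ _
      (fun x hx => Finset.mem_erase.2 ⟨hi x (by simpa using hx), Finset.mem_univ _⟩) b ρ hρ
    have h3 := Finset.card_le_card h2
    rw [Finset.card_erase_of_mem (Finset.mem_univ _), Finset.card_univ, Fintype.card_fin] at h3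
    omega
  have hnd : ((σ.sort (· ≤ ·)).map β).Nodup := by
    refine List.Nodup.map_on (fun x hx y hy h => ?_) (Finset.sort_nodup _ _)
    rw [← hσβ x (by simpa using hx), h, hσβ y (by simpa using hy)]
  obtain ⟨ε, hε, h⟩ := vertexMap_single_of_nodup β _ hnd a
  rw [Finset.length_sort, hσ] at h
  have huniv : ((σ.sort (· ≤ ·)).map β).toFinset = Finset.univ := by
    refine Finset.eq_univ_of_forall fun i => ?_
    rw [List.mem_toFinset, List.mem_map]
    exact ⟨s i, by simp [σ], hs i⟩
  have h0 := hP w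
  rw [hPw, map_zero, hwz, ← hP, sortHom_single, h, huniv, map_zsmul] at h0
  have h1 : augBoundary (Fin (j + 1 + 2)) A (Finsupp.single Finset.univ a) = 0 := by
    rw [← one_smul ℤ (augBoundary _ _ _), ← hε, mul_smul, ← h0, smul_zero]
  -- The full simplex contains `0`, so it is the cone of its own boundary, which would be zero.
  have h2 := augBoundary_cone (0 : Fin (j + 1 + 2)) (Finsupp.single Finset.univ a)
  rw [h1, cone_single_of_mem (Finset.mem_univ _), map_zero, map_zero, sub_zero] at h2
  exact ha (Finsupp.single_eq_zero.1 h2.symm)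

theorem isFaceOfDim_skeleton_blockComplex {ι : Type w} {β : V → ι} {d m : ℕ} (hm : m ≤ d)
    {σ : Finset V} (hσ : σ.card = m + 1) {i : ι} (hi : ∀ v ∈ σ, β v ≠ i) :
    ((blockComplex β d).skeleton m).IsFaceOfDim m σ :=
  ⟨⟨⟨Finset.card_pos.1 (by omega), by omega, i, hi⟩, hσ.le⟩, hσ⟩

theorem vertexSet_blockComplex {ι : Type w} [Nontrivial ι] (β : V → ι) (d : ℕ) :
    (blockComplex β d).vertexSet = Set.univ := by
  refine Set.eq_univ_of_forall fun v => ?_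
  obtain ⟨i, hi⟩ := exists_ne (β v)
  exact ⟨Finset.singleton_nonempty v, by simp, i, by simpa using hi.symm⟩

/-- Vertices of `σ` are exchanged one by one for vertices of `τ`; every intermediate set still
avoids block `i`. -/
theorem transGen_of_same_block [DecidableEq V] {ι : Type w} {β : V → ι} {d m : ℕ} (hm : m ≤ d)
    (i : ι) {τ : Finset V}
    (hτ : τ.card = m + 1) (hτi : ∀ v ∈ τ, β v ≠ i) (n : ℕ) (σ : Finset V) (hσ : σ.card = m + 1)
    (hσi : ∀ v ∈ σ, β v ≠ i) (hn : (τ \ σ).card ≤ n) :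
    Relation.TransGen (((blockComplex β d).skeleton m).SharesFace m) σ τ := by
  have face {σ : Finset V} (hσ : σ.card = m + 1) (hi : ∀ v ∈ σ, β v ≠ i) :=
    isFaceOfDim_skeleton_blockComplex hm hσ hi
  induction n generalizing σ with
  | zero =>
    have h1 : τ ⊆ σ := by simpa using hn
    obtain rfl : τ = σ := Finset.eq_of_subset_of_card_le h1 (by omega)
    obtain ⟨ρ, h2, h3⟩ := Finset.exists_subset_card_eq (s := τ) (n := m) (by omega)
    exact .single ⟨face hτ hτi, face hτ hτi, ρ, h2, h2, h3⟩
  | succ n ih =>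
    by_cases h0 : τ \ σ = ∅
    · exact ih σ hσ hσi (by simp [h0])
    obtain ⟨y, hy⟩ := Finset.nonempty_iff_ne_empty.2 h0
    have hcomm : (τ \ σ).card = (σ \ τ).card := Finset.card_sdiff_comm (hτ.trans hσ.symm)
    obtain ⟨x, hx⟩ : (σ \ τ).Nonempty :=
      Finset.card_pos.1 (hcomm ▸ Finset.card_pos.2 ⟨y, hy⟩)
    rw [Finset.mem_sdiff] at hx
    have hy' := Finset.mem_sdiff.1 hy
    have hy'' : y ∉ σ.erase x := fun h => hy'.2 (Finset.mem_of_mem_erase h)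
    have hcard : (σ.erase x).card = m := by rw [Finset.card_erase_of_mem hx.1, hσ]; rfl
    have hσ' : (insert y (σ.erase x)).card = m + 1 := by
      rw [Finset.card_insert_of_notMem hy'', hcard]
    have hσi' : ∀ v ∈ insert y (σ.erase x), β v ≠ i := by
      intro v hv
      rcases Finset.mem_insert.1 hv with rfl | hv
      · exact hτi _ hy'.1
      · exact hσi v (Finset.mem_of_mem_erase hv)
    refine Relation.TransGen.head ⟨face hσ hσi, face hσ' hσi', σ.erase x, Finset.erase_subset _ _,
      Finset.subset_insert _ _, hcard⟩ (ih _ hσ' hσi' ?_)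
    have hsub : τ \ insert y (σ.erase x) ⊆ (τ \ σ).erase y := by
      intro v hv
      simp only [Finset.mem_sdiff, Finset.mem_insert, Finset.mem_erase, not_or, not_and] at hv ⊢
      refine ⟨hv.2.1, hv.1, hv.2.2 ?_⟩
      rintro rfl
      exact hx.2 hv.1
    have := Finset.card_le_card hsub
    rw [Finset.card_erase_of_mem hy] at this
    omega

variable [Fintype V] {ι : Type w} [DecidableEq ι] {β : V → ι} {d m : ℕ}

theorem exists_superset_blockComplex (hd : ∀ i, d + 1 ≤ (Finset.univ.filter (β · ≠ i)).card)
    {m : ℕ} (hm : m ≤ d) {σ : Finset V} (hσ : σ ∈ (blockComplex β d).faces)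
    (hσm : σ.card ≤ m + 1) :
    ∃ τ, (blockComplex β d).IsFaceOfDim m τ ∧ σ ⊆ τ := by
  obtain ⟨-, -, i, hi⟩ := hσ
  obtain ⟨τ, h1, h2, h3⟩ := Finset.exists_subsuperset_card_eq
    (s := σ) (t := Finset.univ.filter (β · ≠ i)) (n := m + 1)
    (fun v hv => by simpa using hi v hv) hσm (by have := hd i; omega)
  exact ⟨τ, ⟨⟨Finset.card_pos.1 (by omega), by omega, i, fun v hv => by simpa using h2 hv⟩, h3⟩, h1⟩

theorem isPure_blockComplex (hd : ∀ i, d + 1 ≤ (Finset.univ.filter (β · ≠ i)).card) :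
    (blockComplex β d).IsPure d :=
  fun _ hσ => exists_superset_blockComplex hd le_rfl hσ hσ.2.1

/-- Every `m`-face can be led to one avoiding the hub block `L`. To pass from avoiding `i` to
avoiding `L`, take `m` vertices outside both blocks and swap an added vertex of block `L` for one of
block `i`. -/
theorem stronglyConnectedWrt_blockComplex (hβ : Function.Surjective β)
    (hd : ∀ i, d + 1 ≤ (Finset.univ.filter (β · ≠ i)).card) (hm : m ≤ d) (L : ι)
    (hL : ∀ i, m ≤ (Finset.univ.filter fun v => β v ≠ i ∧ β v ≠ L).card) :
    (blockComplex β d).StronglyConnectedWrt m := by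
  classical
  refine ⟨fun σ hσ => ?_, fun σ hσ => ?_, ?_⟩
  · obtain ⟨τ, hτ, hle⟩ := isPure_blockComplex hd σ hσ.1
    have h1 := Finset.card_le_card (hσ.2 hτ.1 hle)
    rw [hτ.2] at h1
    omega
  · obtain ⟨τ, hτ, hle⟩ := exists_superset_blockComplex hd hm hσ.1 hσ.2
    exact ⟨τ, ⟨⟨hτ.1, hτ.2.le⟩, hτ.2⟩, hle⟩
  · have toL : ∀ σ, ((blockComplex β d).skeleton m).IsFaceOfDim m σ → ∃ τ : Finset V,
        τ.card = m + 1 ∧ (∀ v ∈ τ, β v ≠ L) ∧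
        Relation.TransGen (((blockComplex β d).skeleton m).SharesFace m) σ τ := by
      rintro σ ⟨⟨⟨-, -, i, hi⟩, -⟩, hσ⟩
      by_cases hiL : i = L
      · subst hiL
        exact ⟨σ, hσ, hi, transGen_of_same_block hm i hσ hi _ σ hσ hi le_rfl⟩
      obtain ⟨ρ, h1, h2⟩ := Finset.exists_subset_card_eq (hL i)
      have h1 : ∀ v ∈ ρ, β v ≠ i ∧ β v ≠ L := fun v hv => by simpa using h1 hv
      obtain ⟨x, hx⟩ := hβ L
      obtain ⟨y, hy⟩ := hβ i
      have hxρ : x ∉ ρ := fun h => (h1 x h).2 hx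
      have hyρ : y ∉ ρ := fun h => (h1 y h).1 hy
      have hcx : (insert x ρ).card = m + 1 := by rw [Finset.card_insert_of_notMem hxρ, h2]
      have hcy : (insert y ρ).card = m + 1 := by rw [Finset.card_insert_of_notMem hyρ, h2]
      have hx' : ∀ v ∈ insert x ρ, β v ≠ i := by
        simp only [Finset.forall_mem_insert]
        exact ⟨fun h => hiL (h.symm.trans hx), fun v hv => (h1 v hv).1⟩
      have hy' : ∀ v ∈ insert y ρ, β v ≠ L := by
        simp only [Finset.forall_mem_insert]
        exact ⟨fun h => hiL (hy.symm.trans h), fun v hv => (h1 v hv).2⟩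
      exact ⟨insert y ρ, hcy, hy', (transGen_of_same_block hm i hcx hx' _ σ hσ hi le_rfl).tail
        ⟨isFaceOfDim_skeleton_blockComplex hm hcx hx', isFaceOfDim_skeleton_blockComplex hm hcy hy',
          ρ, Finset.subset_insert _ _, Finset.subset_insert _ _, h2⟩⟩
    have hsymm : ∀ {σ τ}, Relation.TransGen (((blockComplex β d).skeleton m).SharesFace m) σ τ →
        Relation.TransGen (((blockComplex β d).skeleton m).SharesFace m) τ σ := by
      intro σ τ h
      induction h with
      | single h =>
        obtain ⟨h1, h2, ρ, h3, h4, h5⟩ := h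
        exact .single ⟨h2, h1, ρ, h4, h3, h5⟩
      | tail _ h ih =>
        obtain ⟨h1, h2, ρ, h3, h4, h5⟩ := h
        exact .head ⟨h2, h1, ρ, h4, h3, h5⟩ ih
    intro σ τ hσ hτ
    obtain ⟨σ', h1, h2, h3⟩ := toL σ hσ
    obtain ⟨τ', h4, h5, h6⟩ := toL τ hτ
    exact (h3.trans (transGen_of_same_block hm L h4 h5 _ σ' h1 h2 le_rfl)).trans (hsymm h6)

end Blocks

/-! ### Block sizes -/

section BlockMap

/-- The first `s` points form the last block, and the others are distributed cyclically over the
remaining `k + 1` blocks. -/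
def blockMap (n s k : ℕ) (x : Fin n) : Fin (k + 2) :=
  if x.1 < s then Fin.last (k + 1)
  else (⟨(x.1 - s) % (k + 1), Nat.mod_lt _ k.succ_pos⟩ : Fin (k + 1)).castSucc

variable {n s k c : ℕ}

theorem blockMap_surjective (hs : 1 ≤ s) (hn : s + (k + 1) ≤ n) :
    Function.Surjective (blockMap n s k) := by
  intro i
  induction i using Fin.lastCases with
  | last => exact ⟨⟨0, by omega⟩, by rw [blockMap, if_pos (show 0 < s from hs)]⟩
  | cast i =>
    refine ⟨⟨s + i, by omega⟩, ?_⟩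
    rw [blockMap, if_neg (by simp)]
    congr 1
    ext
    simp [Nat.mod_eq_of_lt i.2]

theorem card_blockMap_last_le :
    (Finset.univ.filter (blockMap n s k · = Fin.last (k + 1))).card ≤ s := by
  rw [← Finset.card_range s]
  refine Finset.card_le_card_of_injOn Fin.val (fun x hx => ?_) Fin.val_injective.injOn
  have hx : blockMap n s k x = Fin.last (k + 1) := by simpa using hx
  by_contra h
  rw [blockMap, if_neg (by simpa using h)] at hx
  exact (Fin.castSucc_lt_last _).ne hx

/-- On a residue class modulo `k + 1`, the quotient of `x - s` by `k + 1` is injective, and it is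
less than `c`. -/
theorem card_blockMap_le (hs : s ≤ c) (hn : n ≤ s + (k + 1) * c) (i : Fin (k + 2)) :
    (Finset.univ.filter (blockMap n s k · = i)).card ≤ c := by
  induction i using Fin.lastCases with
  | last => exact card_blockMap_last_le.trans hs
  | cast i =>
    rw [← Finset.card_range c]
    have key : ∀ x : Fin n, blockMap n s k x = i.castSucc →
        s ≤ x.1 ∧ (x.1 - s) % (k + 1) = i := by
      intro x hx
      by_cases h : x.1 < s
      · rw [blockMap, if_pos h] at hx
        exact absurd hx.symm (Fin.castSucc_lt_last i).ne
      · rw [blockMap, if_neg h, Fin.castSucc_inj] at hx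
        exact ⟨by omega, congrArg Fin.val hx⟩
    refine Finset.card_le_card_of_injOn (fun x => (x.1 - s) / (k + 1)) (fun x hx => ?_) ?_
    · simp only [Finset.coe_range, Set.mem_Iio]
      have := x.2
      have hpos : 0 < s + (k + 1) * c := by omega
      rw [Nat.div_lt_iff_lt_mul (by omega : 0 < k + 1), mul_comm c]
      have := (key x (by simpa using hx)).1
      omega
    · intro x hx y hy hxy
      have h1 := key x (by simpa using hx)
      have h2 := key y (by simpa using hy)
      have e1 := Nat.div_add_mod (x.1 - s) (k + 1)
      have e2 := Nat.div_add_mod (y.1 - s) (k + 1)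
      simp only at hxy
      rw [hxy, h1.2] at e1
      rw [h2.2] at e2
      ext
      omega

end BlockMap

/-! ### Numerical bounds and the extremal complex -/

/-- With `q = ⌈(d + 1) / (k + 1)⌉`, the bound `(q - 1) * (k + 1) < d + 1` turns the hypothesis on
`m` into `(q - 1) * k < m`. Hence `q ≤ ⌈m / k⌉`, while `d + 1 - m < q`. -/
theorem ceil_bounds {d k m : ℕ} (hk : 1 ≤ k) (hmd : m ≤ d)
    (hm : (d : ℤ) + 1 - ⌈((d : ℚ) + 1) / ((k : ℚ) + 1)⌉ < (m : ℤ)) :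
    m ≤ k * ⌈(m : ℚ) / (k : ℚ)⌉₊ ∧ d + 1 - m ≤ ⌈(m : ℚ) / (k : ℚ)⌉₊ ∧ k + 1 ≤ m := by
  have hc : m ≤ k * ⌈(m : ℚ) / (k : ℚ)⌉₊ := by
    have h := Nat.le_ceil ((m : ℚ) / (k : ℚ))
    rw [div_le_iff₀ (by exact_mod_cast hk), mul_comm] at h
    exact_mod_cast h
  set c := ⌈(m : ℚ) / (k : ℚ)⌉₊
  set q := ⌈((d : ℚ) + 1) / ((k : ℚ) + 1)⌉ with hq
  have hqd : (q - 1) * (k + 1) < d + 1 := by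
    have h := Int.ceil_lt_add_one (((d : ℚ) + 1) / ((k : ℚ) + 1))
    rw [← hq, ← sub_lt_iff_lt_add, lt_div_iff₀ (by positivity)] at h
    exact_mod_cast h
  have hmq : (q - 1) * k + 1 ≤ m := by linarith
  have hq2 : 2 ≤ q := by omega
  have hcq : q ≤ c := by
    by_contra! h
    have hck : (k : ℤ) * c ≤ k * (q - 1) := mul_le_mul_of_nonneg_left (by omega) (by positivity)
    have : (m : ℤ) ≤ k * c := by exact_mod_cast hc
    linarith
  refine ⟨hc, by omega, ?_⟩
  have : (1 : ℤ) * k ≤ (q - 1) * k := mul_le_mul_of_nonneg_right (by omega) (by positivity)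
  omega

theorem exists_blockComplex {d k m : ℕ} (hk : 1 ≤ k) (hkd : k ≤ d) (hmd : m ≤ d)
    (hm : (d : ℤ) + 1 - ⌈((d : ℚ) + 1) / ((k : ℚ) + 1)⌉ < (m : ℤ)) :
    ∃ X : PreAbstractSimplicialComplex (Fin (d + 1 + ⌈(m : ℚ) / (k : ℚ)⌉₊)),
      X.IsPure d ∧ X.StronglyConnectedWrt m ∧
        (∀ (A : Type u) [AddCommGroup A] [Nontrivial A], Nontrivial (X.Homology A k)) ∧
        X.vertexSet.encard = ((d + 1 + ⌈(m : ℚ) / (k : ℚ)⌉₊ : ℕ) : ℕ∞) := by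
  obtain ⟨hc, hs, hkm⟩ := ceil_bounds hk hmd hm
  set c := ⌈(m : ℚ) / (k : ℚ)⌉₊
  -- The size `s = d + 1 - m` of the hub block leaves `(d + 1 + c) - c - s = m` vertices outside it
  -- and any other block; the remaining `m + c ≤ (k + 1) * c` vertices fit into `k + 1` blocks of
  -- size at most `c`.
  have hβ := blockMap_surjective (n := d + 1 + c) (s := d + 1 - m) (k := k) (by omega) (by omega)
  have hfib := card_blockMap_le (n := d + 1 + c) (s := d + 1 - m) (k := k) hs
    (by rw [add_mul]; omega)
  have hlast := card_blockMap_last_le (n := d + 1 + c) (s := d + 1 - m) (k := k)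
  set β := blockMap (d + 1 + c) (d + 1 - m) k
  have hd : ∀ i, d + 1 ≤ (Finset.univ.filter (β · ≠ i)).card := by
    intro i
    have h := Finset.card_filter_add_card_filter_not (s := Finset.univ) (β · = i)
    rw [Finset.card_univ, Fintype.card_fin] at h
    have := hfib i
    simp only [ne_eq]
    omega
  refine ⟨blockComplex β d, isPure_blockComplex hd,
    stronglyConnectedWrt_blockComplex hβ hd hmd (Fin.last (k + 1)) fun i => ?_,
    fun A _ _ => nontrivial_homology_blockComplex hβ hk hkd A, ?_⟩
  · have h := Finset.card_filter_add_card_filter_not (s := Finset.univ)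
      fun v => β v = i ∨ β v = Fin.last (k + 1)
    rw [Finset.card_univ, Fintype.card_fin, Finset.filter_or] at h
    have h1 := Finset.card_union_le (Finset.univ.filter (β · = i))
      (Finset.univ.filter (β · = Fin.last (k + 1)))
    have := hfib i
    simp only [not_or] at h
    simp only [ne_eq]
    omega
  · rw [vertexSet_blockComplex, Set.encard_univ, ENat.card_eq_coe_fintype_card, Fintype.card_fin]

end PreAbstractSimplicialComplex

theorem theorem1p3 (d k m : ℕ) (hk : 1 ≤ k) (hkd : k ≤ d)
    (hm : (d : ℤ) + 1 - ⌈((d : ℚ) + 1) / ((k : ℚ) + 1)⌉ < (m : ℤ)) :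
    (∀ (A : Type u) [AddCommGroup A] (V : Type v) [LinearOrder V]
      (X : PreAbstractSimplicialComplex V),
      X.IsPure d → X.StronglyConnectedWrt m → Nontrivial (X.Homology A k) →
        ((d + 1 + ⌈(m : ℚ) / (k : ℚ)⌉₊ : ℕ) : ℕ∞) ≤ X.vertexSet.encard) ∧
    (m ≤ d → ∃ X : PreAbstractSimplicialComplex (Fin (d + 1 + ⌈(m : ℚ) / (k : ℚ)⌉₊)),
      X.IsPure d ∧ X.StronglyConnectedWrt m ∧
        (∀ (A : Type u) [AddCommGroup A] [Nontrivial A], Nontrivial (X.Homology A k)) ∧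
        X.vertexSet.encard = ((d + 1 + ⌈(m : ℚ) / (k : ℚ)⌉₊ : ℕ) : ℕ∞)) := by
  exact ⟨fun A _ V _ X hX hXm hH =>
      PreAbstractSimplicialComplex.le_encard_vertexSet hk hX hXm hH,
    fun hmd => PreAbstractSimplicialComplex.exists_blockComplex hk hkd hmd hm⟩
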